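/- Throughout, $\log$ is the logarithm to base $2$. A private coin simultaneous message protocol $\Pi$ for a function $g:\mathcal X\times\mathcal Y\to\mathcal Z$ ($\mathcal X,\mathcal Y$ finite and nonempty) works as follows: on input $x\in\mathcal X$ Alice sends a random bit string of fixed length $\ell_A$, on input $y\in\mathcal Y$ Bob sends a random bit string of fixed length $\ell_B$, where the two messages are generated with independent private coins, and a referee who sees only the two messages determines the answer from them by a fixed rule. The cost of $\Pi$ is $\ell_A+\ell_B$, and $\Pi$ is a $\delta$-error protocol for $g$ if for every $(x,y)$ the answer equals $g(x,y)$ with probability at least $1-\delta$. Let $R^{\mathrm{sim}}_\delta(g)$ be the minimum cost of a $\delta$-error protocol for $g$. Let $\mathrm{IC}^{\mathrm{sim}}_\delta(g)$ be the infimum, over all $\delta$-error protocols $\Pi$ for $g$, of the mutual information $I(XY:\Pi(X,Y))$, where $(X,Y)$ is uniform on $\mathcal X\times\mathcal Y$ and $\Pi(x,y)$ is the pair of messages sent on input $(x,y)$. For $m\ge 0$ let $g^m:\mathcal X^m\times\mathcal Y^m\to\mathcal Z^m$ be $g^m((x_i)_i,(y_i)_i)=(g(x_i,y_i))_i$. Let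 $n\ge 0$, let $f:\{0,1\}^n\times\{0,1\}^n\to\mathcal Z$ be a function, and let $\delta>0$ and $0<\epsilon<1$. (i) There exist sets $\mathsf{Good}_A,\mathsf{Good}_B\subseteq\{0,1\}^n$ with $|\mathsf{Good}_A|\ge\frac23\cdot 2^n$ and $|\mathsf{Good}_B|\ge\frac23\cdot 2^n$ such that $$\mathrm{IC}^{\mathrm{sim}}_\delta(f)\ \ge\ \frac{\epsilon}{3}\Bigl(R^{\mathrm{sim}}_{\delta+4\epsilon}(f')-2\log(n+1)-2\log\frac{1}{\epsilon^2(1-\epsilon)}-\frac2\epsilon-8\Bigr),$$ where $f'$ is the restriction of $f$ to $\mathsf{Good}_A\times\mathsf{Good}_B$. (ii) Let $\tilde R^{\mathrm{sim}}_{\eta}(f)=\min_{A,B}R^{\mathrm{sim}}_{\eta}(f|_{A\times B})$, where $A,B$ range over the subsets of $\{0,1\}^n$ with $|A|,|B|\ge\frac23\cdot 2^n$. Then for every integer $m\ge 0$, $$R^{\mathrm{sim}}_\delta(f^m)\ \ge\ \frac{m\epsilon}{3}\Bigl(\tilde R^{\mathrm{sim}}_{\delta+4\epsilon}(f)-2\log(n+1)-2\log\frac{1}{\epsilon^2(1-\epsilon)}-\frac2\epsilon-8\Bigr).$$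 -/

import Mathlib

/-- Shannon entropy, in bits, of a distribution on a finite set. -/
noncomputable def shannonEntropy {α : Type*} [Fintype α] (p : PMF α) : ℝ :=
  -∑ a, (p a).toReal * Real.logb 2 (p a).toReal

/-- Mutual information `I(U : V) = H(U) + H(V) - H(UV)`, in bits, of a pair of random variables
with joint distribution `p`. -/
noncomputable def mutualInfo {α β : Type*} [Fintype α] [Fintype β] (p : PMF (α × β)) : ℝ :=
  shannonEntropy (p.map Prod.fst) + shannonEntropy (p.map Prod.snd) - shannonEntropy p

/-- A private coin simultaneous message protocol with inputs in `X`, `Y` and outputs in `Z`.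
On input `x` Alice tosses her private coins and sends the referee a string of `lenA` bits, and
independently Bob sends a string of `lenB` bits on input `y`; only the distribution of each
message given the sender's input matters. The referee sees the two messages and nothing else. -/
structure SimProtocol (X Y Z : Type*) where
  lenA : ℕ
  lenB : ℕ
  alice : X → PMF (Fin lenA → Bool)
  bob : Y → PMF (Fin lenB → Bool)
  referee : (Fin lenA → Bool) → (Fin lenB → Bool) → Z

namespace SimProtocol

variable {X Y Z : Type*}

/-- Communication cost: the total number of bits sent. -/
def cost (P : SimProtocol X Y Z) : ℕ := P.lenA + P.lenB

/-- Distribution of the transcript (the pair of messages) on input `(x, y)`: the private coins of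
Alice and Bob are independent. -/
noncomputable def transcript (P : SimProtocol X Y Z) (x : X) (y : Y) :
    PMF ((Fin P.lenA → Bool) × (Fin P.lenB → Bool)) :=
  (P.alice x).bind fun u => (P.bob y).map fun v => (u, v)

open Classical in
/-- The probability, over the coin tosses of Alice and Bob, that the referee announces `z` on
input `(x, y)`. -/
noncomputable def probOutput (P : SimProtocol X Y Z) (x : X) (y : Y) (z : Z) : ℝ :=
  ∑ t, if P.referee t.1 t.2 = z then (P.transcript x y t).toReal else 0

/-- `P` is a `δ`-error protocol for `f`: on every input the answer is correct with probability at
least `1 - δ`. -/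
def Computes (P : SimProtocol X Y Z) (f : X → Y → Z) (δ : ℝ) : Prop :=
  ∀ x y, 1 - δ ≤ P.probOutput x y (f x y)

/-- Joint distribution of the input pair, drawn from `μ`, and the transcript on that input. -/
noncomputable def joint (P : SimProtocol X Y Z) (μ : PMF (X × Y)) :
    PMF ((X × Y) × ((Fin P.lenA → Bool) × (Fin P.lenB → Bool))) :=
  μ.bind fun xy => (P.transcript xy.1 xy.2).map fun t => (xy, t)

/-- Information cost `I(XY : Π(X, Y))` of the protocol under the input distribution `μ`. -/
noncomputable def infoCost [Fintype X] [Fintype Y] (P : SimProtocol X Y Z) (μ : PMF (X × Y)) : ℝ :=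
  mutualInfo (P.joint μ)

end SimProtocol

/-- `R^sim_δ(f)`: the least cost of a private coin simultaneous `δ`-error protocol for `f`. -/
noncomputable def Rsim {X Y Z : Type*} (δ : ℝ) (f : X → Y → Z) : ℕ :=
  sInf {c | ∃ P : SimProtocol X Y Z, P.Computes f δ ∧ P.cost = c}

/-- `IC^sim_δ(f)`: the infimum information cost, under the uniform distribution on the inputs, of
a private coin simultaneous `δ`-error protocol for `f`. -/
noncomputable def ICsim {X Y Z : Type*} [Fintype X] [Nonempty X] [Fintype Y] [Nonempty Y]
    (δ : ℝ) (f : X → Y → Z) : ℝ :=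
  sInf {r | ∃ P : SimProtocol X Y Z, P.Computes f δ ∧
    P.infoCost (PMF.uniformOfFintype (X × Y)) = r}

/-- The restriction of `f` to `A × B`. -/
def restrictRect {X Y Z : Type*} (f : X → Y → Z) (A : Finset X) (B : Finset Y) : A → B → Z :=
  fun x y => f x y

/-- `S` contains at least two thirds of all `n`-bit strings. -/
def IsLarge {n : ℕ} (S : Finset (Fin n → Bool)) : Prop :=
  (2 / 3 : ℝ) * 2 ^ n ≤ (S.card : ℝ)

/-- `R̃^sim_δ(f)`: the minimum of `R^sim_δ` over the restrictions of `f` to rectangles with both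
sides large. -/
noncomputable def RsimTilde {n : ℕ} {Z : Type*} (δ : ℝ)
    (f : (Fin n → Bool) → (Fin n → Bool) → Z) : ℕ :=
  sInf {c | ∃ A B : Finset (Fin n → Bool), IsLarge A ∧ IsLarge B ∧
    Rsim δ (restrictRect f A B) = c}

/-- The `m`-fold direct sum `f^m`. -/
def directSumFun {X Y Z : Type*} (m : ℕ) (f : X → Y → Z) :
    (Fin m → X) → (Fin m → Y) → (Fin m → Z) :=
  fun x y i => f (x i) (y i)

/-! Private coins make the two messages independent, so the information cost under uniform inputs is
a + b, the information in Alice's message plus that in Bob's (`infoCost_uniform`). Write p_x for the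
law of Alice's message on x and q for its average. Then a is the mean of D(p_x‖q), so by Markov at
least two thirds of the x satisfy D(p_x‖q) ≤ 3a; the same holds for Bob.

For such x, most of the mass of p_x lies where p_x ≤ K q, with log K of order a/ε. Rejection
sampling therefore imitates p_x using about K n samples from q. A Chernoff bound and a union bound
over the at most 4^n input pairs fix one list of samples that serves all of them (`exists_samples`).
Alice then sends only an index into the list, drawn in proportion to the acceptance probabilities
(`exists_compression`). Only upward deviations of the error matter. Alice is compressed against
Bob's original message, then Bob against Alice's compressed one; each round adds at most 2ε to the
error.

For the direct sum, an input is planted in coordinate i and the other coordinates are filled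
privately and uniformly. This keeps the error bound, and the m information costs add up to at most
that of the whole protocol (`sum_chanInfo_coordChan_le`), hence at most its communication. -/

open Finset

/-! ### Relative entropy and the information of a channel with uniform input -/

section Info

variable {M N V W ι : Type*} [Fintype M] [Fintype N] [Fintype V] [Fintype W] [Fintype ι]

/-- Relative entropy, in bits, of two nonnegative functions on a finite set. -/
noncomputable def relEntropy (p q : M → ℝ) : ℝ := ∑ m, p m * Real.logb 2 (p m / q m)

theorem mul_logb_div_ge {a b : ℝ} (ha : 0 ≤ a) (hb : 0 ≤ b) (hab : b = 0 → a = 0) :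
    (a - b) / Real.log 2 ≤ a * Real.logb 2 (a / b) := by
  have hl : 0 < Real.log 2 := Real.log_pos (by norm_num)
  rw [Real.logb, ← mul_div_assoc]
  refine (div_le_div_iff_of_pos_right hl).2 ?_
  rcases ha.eq_or_lt with rfl | ha
  · simpa using hb
  have hb : 0 < b := lt_of_le_of_ne hb fun h => ha.ne' (hab h.symm)
  have h := Real.log_le_sub_one_of_pos (div_pos hb ha)
  rw [← inv_div b a, Real.log_inv]
  have h2 : a * (b / a) = b := by field_simp
  nlinarith

/-- Gibbs' inequality. Absolute continuity is needed because a term with `q m = 0` counts as 0 here,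
not as infinity. Mass at most 1 for `q` is enough. -/
theorem relEntropy_nonneg {p q : M → ℝ} (hp : p ∈ stdSimplex ℝ M) (hq : ∀ m, 0 ≤ q m)
    (hq1 : ∑ m, q m ≤ 1) (hpq : ∀ m, q m = 0 → p m = 0) : 0 ≤ relEntropy p q := by
  have hl : 0 < Real.log 2 := Real.log_pos (by norm_num)
  calc (0 : ℝ) ≤ (∑ m, p m - ∑ m, q m) / Real.log 2 :=
        div_nonneg (by rw [hp.2]; linarith) hl.le
    _ = ∑ m, (p m - q m) / Real.log 2 := by rw [← sum_sub_distrib, sum_div]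
    _ ≤ _ := sum_le_sum fun m _ => mul_logb_div_ge (hp.1 m) (hq m) (hpq m)

/-- Output distribution of a channel with uniform input. -/
noncomputable def chanAvg {α : Type*} (κ : W → α → ℝ) (m : α) : ℝ := (∑ w, κ w m) / Fintype.card W

/-- Mutual information between a uniform input of a channel and its output. -/
noncomputable def chanInfo (κ : W → M → ℝ) : ℝ :=
  (∑ w, relEntropy (κ w) (chanAvg κ)) / Fintype.card W

theorem chanAvg_mem [Nonempty W] {κ : W → M → ℝ} (hκ : ∀ w, κ w ∈ stdSimplex ℝ M) :
    chanAvg κ ∈ stdSimplex ℝ M := by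
  refine ⟨fun m => div_nonneg (sum_nonneg fun w _ => (hκ w).1 m) (by positivity), ?_⟩
  simp only [chanAvg]
  rw [← sum_div, sum_comm, sum_congr rfl fun w _ => (hκ w).2]
  simp

theorem eq_zero_of_chanAvg_eq_zero [Nonempty W] {κ : W → M → ℝ}
    (hκ : ∀ w, κ w ∈ stdSimplex ℝ M) {m : M} (h : chanAvg κ m = 0) (w : W) : κ w m = 0 := by
  have hc : (Fintype.card W : ℝ) ≠ 0 := by simp
  rw [chanAvg, div_eq_zero_iff, or_iff_left hc,
    sum_eq_zero_iff_of_nonneg fun w _ => (hκ w).1 m] at h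
  exact h w (mem_univ w)

theorem relEntropy_chanAvg_nonneg [Nonempty W] {κ : W → M → ℝ}
    (hκ : ∀ w, κ w ∈ stdSimplex ℝ M) (w : W) : 0 ≤ relEntropy (κ w) (chanAvg κ) :=
  relEntropy_nonneg (hκ w) (chanAvg_mem hκ).1 (chanAvg_mem hκ).2.le
    fun _ h => eq_zero_of_chanAvg_eq_zero hκ h w

theorem chanInfo_nonneg [Nonempty W] {κ : W → M → ℝ} (hκ : ∀ w, κ w ∈ stdSimplex ℝ M) :
    0 ≤ chanInfo κ :=
  div_nonneg (sum_nonneg fun w _ => relEntropy_chanAvg_nonneg hκ w) (by positivity)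

/-- Information is at most the output entropy because `κ w m ≤ 1`, and entropy is at most the log of
the alphabet size by comparison with the uniform law. -/
theorem chanInfo_le_logb_card [Nonempty W] {κ : W → M → ℝ}
    (hκ : ∀ w, κ w ∈ stdSimplex ℝ M) : chanInfo κ ≤ Real.logb 2 (Fintype.card M) := by
  have hQ := chanAvg_mem hκ
  have hW : (0 : ℝ) < Fintype.card W := by positivity
  have hMne : Nonempty M := by
    by_contra h
    rw [not_nonempty_iff] at h
    simpa using hQ.2
  have hM : (0 : ℝ) < Fintype.card M := by positivity
  have h1 : chanInfo κ ≤ -∑ m, chanAvg κ m * Real.logb 2 (chanAvg κ m) := by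
    rw [chanInfo, div_le_iff₀ hW, neg_mul, sum_mul, ← sum_neg_distrib]
    simp only [relEntropy]
    rw [sum_comm]
    refine sum_le_sum fun m _ => ?_
    have e : -(chanAvg κ m * Real.logb 2 (chanAvg κ m) * Fintype.card W)
        = ∑ w, κ w m * -Real.logb 2 (chanAvg κ m) := by
      rw [← sum_mul]
      have : ∑ w, κ w m = chanAvg κ m * Fintype.card W := by rw [chanAvg]; field_simp
      rw [this]; ring
    rw [e]
    refine sum_le_sum fun w _ => ?_
    rcases ((hκ w).1 m).eq_or_lt with h0 | h0
    · simp [← h0]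
    refine mul_le_mul_of_nonneg_left ?_ h0.le
    have hq : chanAvg κ m ≠ 0 := fun h => h0.ne' (eq_zero_of_chanAvg_eq_zero hκ h w)
    rw [Real.logb_div h0.ne' hq]
    have : κ w m ≤ 1 := by
      rw [← (hκ w).2]; exact single_le_sum (fun m _ => (hκ w).1 m) (mem_univ m)
    have := Real.logb_nonpos (b := 2) (by norm_num) h0.le this
    linarith
  have h2 : 0 ≤ relEntropy (chanAvg κ) fun _ => (Fintype.card M : ℝ)⁻¹ :=
    relEntropy_nonneg hQ (fun _ => by positivity) (by simp) (by simp)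
  have h3 : relEntropy (chanAvg κ) (fun _ => (Fintype.card M : ℝ)⁻¹)
      = ∑ m, chanAvg κ m * Real.logb 2 (chanAvg κ m) + Real.logb 2 (Fintype.card M) := by
    calc _ = ∑ m, (chanAvg κ m * Real.logb 2 (chanAvg κ m)
          + chanAvg κ m * Real.logb 2 (Fintype.card M)) := by
          refine sum_congr rfl fun m _ => ?_
          rcases eq_or_ne (chanAvg κ m) 0 with h0 | h0
          · simp [h0]
          rw [div_inv_eq_mul, Real.logb_mul h0 hM.ne', mul_add]
      _ = _ := by rw [sum_add_distrib, ← sum_mul, hQ.2, one_mul]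
  linarith

/-- Two channels used independently. -/
def prodChan {V W α β : Type*} (κ : V → α → ℝ) (η : W → β → ℝ) : V × W → α × β → ℝ :=
  fun x m => κ x.1 m.1 * η x.2 m.2

theorem chanAvg_prodChan {α β : Type*} (κ : V → α → ℝ) (η : W → β → ℝ) (m : α × β) :
    chanAvg (prodChan κ η) m = chanAvg κ m.1 * chanAvg η m.2 := by
  simp only [chanAvg, prodChan, Fintype.sum_prod_type, Fintype.card_prod, Nat.cast_mul]
  rw [div_mul_div_comm, sum_mul_sum]

theorem chanInfo_prodChan [Nonempty V] [Nonempty W] {κ : V → M → ℝ} {η : W → N → ℝ}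
    (hκ : ∀ w, κ w ∈ stdSimplex ℝ M) (hη : ∀ w, η w ∈ stdSimplex ℝ N) :
    chanInfo (prodChan κ η) = chanInfo κ + chanInfo η := by
  have hrel : ∀ x : V × W, relEntropy (prodChan κ η x) (chanAvg (prodChan κ η))
      = relEntropy (κ x.1) (chanAvg κ) + relEntropy (η x.2) (chanAvg η) := by
    rintro ⟨v, w⟩
    have hterm : ∀ (m : M) (k : N),
        κ v m * η w k * Real.logb 2 (κ v m * η w k / (chanAvg κ m * chanAvg η k))
        = κ v m * Real.logb 2 (κ v m / chanAvg κ m) * η w k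
          + κ v m * (η w k * Real.logb 2 (η w k / chanAvg η k)) := by
      intro m k
      rcases eq_or_ne (κ v m) 0 with h | h
      · simp [h]
      rcases eq_or_ne (η w k) 0 with h' | h'
      · simp [h']
      have hq : chanAvg κ m ≠ 0 := fun e => h (eq_zero_of_chanAvg_eq_zero hκ e v)
      have hq' : chanAvg η k ≠ 0 := fun e => h' (eq_zero_of_chanAvg_eq_zero hη e w)
      rw [mul_div_mul_comm, Real.logb_mul (div_ne_zero h hq) (div_ne_zero h' hq')]
      ring
    simp only [relEntropy, chanAvg_prodChan, Fintype.sum_prod_type, prodChan, hterm,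
      sum_add_distrib, ← mul_sum, ← sum_mul, (hκ v).2, (hη w).2, mul_one, one_mul]
  simp only [chanInfo, hrel, Fintype.sum_prod_type, sum_add_distrib, Fintype.card_prod,
    Nat.cast_mul, sum_const, card_univ, nsmul_eq_mul, ← mul_sum]
  field_simp

/-! ### Superadditivity over independent coordinates of the input -/

/-- Exchanging the fresh letter with the one it overwrites is an involution of `W × (ι → W)`. -/
theorem sum_sum_update [DecidableEq ι] (F : (ι → W) → W → ℝ) (i : ι) :
    ∑ w, ∑ x : ι → W, F (Function.update x i w) w = Fintype.card W * ∑ x : ι → W, F x (x i) := by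
  have e : ∑ a : W × (ι → W), F (Function.update a.2 i a.1) a.1
      = ∑ a : W × (ι → W), F a.2 (a.2 i) := by
    refine sum_nbij' (fun a => (a.2 i, Function.update a.2 i a.1))
      (fun a => (a.2 i, Function.update a.2 i a.1)) ?_ ?_ ?_ ?_ ?_ <;> simp
  rw [Fintype.sum_prod_type, Fintype.sum_prod_type] at e
  rw [e]
  simp

/-- The channel that feeds its input into coordinate `i` of `κ` and fills the remaining
coordinates uniformly at random. -/
noncomputable def coordChan {α : Type*} [DecidableEq ι] (κ : (ι → W) → α → ℝ) (i : ι) (w : W)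
    (m : α) : ℝ :=
  (∑ x : ι → W, κ (Function.update x i w) m) / Fintype.card (ι → W)

variable [DecidableEq ι]

theorem coordChan_mem [Nonempty W] {κ : (ι → W) → M → ℝ} (hκ : ∀ w, κ w ∈ stdSimplex ℝ M)
    (i : ι) (w : W) : coordChan κ i w ∈ stdSimplex ℝ M :=
  chanAvg_mem (κ := fun x => κ (Function.update x i w)) fun _ => hκ _

theorem sum_coordChan_mul {α : Type*} [Nonempty W] (κ : (ι → W) → α → ℝ) (i : ι) (φ : W → ℝ)
    (m : α) :
    (∑ w, coordChan κ i w m * φ w) / Fintype.card W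
      = (∑ x, κ x m * φ (x i)) / Fintype.card (ι → W) := by
  have h := sum_sum_update (fun x w => κ x m * φ w) i
  simp only [coordChan, div_mul_eq_mul_div, ← sum_div, sum_mul, h]
  field_simp

theorem chanAvg_coordChan {α : Type*} [Nonempty W] (κ : (ι → W) → α → ℝ) (i : ι) :
    chanAvg (coordChan κ i) = chanAvg κ := by
  funext m
  simpa [chanAvg] using sum_coordChan_mul κ i (fun _ => 1) m

theorem sum_chanInfo_coordChan_le [Nonempty W] {κ : (ι → W) → M → ℝ}
    (hκ : ∀ w, κ w ∈ stdSimplex ℝ M) : ∑ i, chanInfo (coordChan κ i) ≤ chanInfo κ := by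
  set Q := chanAvg κ with hQdef
  have hQ : Q ∈ stdSimplex ℝ M := chanAvg_mem hκ
  have hC := fun i => coordChan_mem hκ i
  have hW : (0 : ℝ) < Fintype.card W := by positivity
  have hK : (0 : ℝ) < Fintype.card (ι → W) := by positivity
  have hKW : (Fintype.card (ι → W) : ℝ) = ∏ _i : ι, (Fintype.card W : ℝ) := by simp
  have hcoord : ∀ i, chanInfo (coordChan κ i) = (∑ x, ∑ m, κ x m *
      Real.logb 2 (coordChan κ i (x i) m / Q m)) / Fintype.card (ι → W) := by
    intro i
    simp only [chanInfo, relEntropy, chanAvg_coordChan, ← hQdef]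
    rw [sum_comm, sum_div, sum_comm (s := (univ : Finset (ι → W))), sum_div]
    exact sum_congr rfl fun m _ =>
      sum_coordChan_mul κ i (fun w => Real.logb 2 (coordChan κ i w m / Q m)) m
  let p : (ι → W) × M → ℝ := fun a => κ a.1 a.2 / Fintype.card (ι → W)
  -- `p` is the joint law of input and message; `q` has the same message law and the same
  -- conditional law of each coordinate, but makes the coordinates conditionally independent given
  -- the message. Nonnegativity of the relative entropy of `p` to `q` is exactly the
  -- superadditivity.
  let q : (ι → W) × M → ℝ := fun a =>
    Q a.2 * ∏ i, (coordChan κ i (a.1 i) a.2 / (Fintype.card W * Q a.2))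
  have hpos : ∀ x m, κ x m ≠ 0 → Q m ≠ 0 ∧ ∀ i, coordChan κ i (x i) m ≠ 0 := by
    intro x m h
    refine ⟨fun e => h (eq_zero_of_chanAvg_eq_zero hκ e x), fun i e => h ?_⟩
    have := eq_zero_of_chanAvg_eq_zero (κ := fun z => κ (Function.update z i (x i)))
      (fun _ => hκ _) e x
    simpa using this
  have hp : p ∈ stdSimplex ℝ ((ι → W) × M) := by
    refine ⟨fun a => div_nonneg ((hκ _).1 _) hK.le, ?_⟩
    simp only [p, Fintype.sum_prod_type, ← sum_div, (hκ _).2]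
    simp
  have hq : ∀ a, 0 ≤ q a := fun a => mul_nonneg (hQ.1 _) <| prod_nonneg fun i _ =>
    div_nonneg ((hC i _).1 _) (mul_nonneg hW.le (hQ.1 _))
  have hq1 : ∑ a, q a ≤ 1 := by
    simp only [q, Fintype.sum_prod_type]
    rw [sum_comm, ← hQ.2]
    refine sum_le_sum fun m _ => ?_
    rw [← mul_sum, ← Fintype.prod_sum (fun i w => coordChan κ i w m / (Fintype.card W * Q m))]
    rcases eq_or_ne (Q m) 0 with h | h
    · simp [h]
    refine (mul_le_of_le_one_right (hQ.1 m) (le_of_eq (prod_eq_one fun i _ => ?_)))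
    have : chanAvg (coordChan κ i) m = Q m := by rw [chanAvg_coordChan]
    rw [← sum_div, mul_comm, ← div_div, div_right_comm]
    change chanAvg (coordChan κ i) m / Q m = 1
    rw [this, div_self h]
  have hpq : ∀ a, q a = 0 → p a = 0 := by
    rintro ⟨x, m⟩ h
    by_contra hne
    have hk : κ x m ≠ 0 := fun e => hne (by simp [p, e])
    obtain ⟨h1, h2⟩ := hpos x m hk
    refine absurd h (mul_ne_zero h1 (prod_ne_zero_iff.2 fun i _ => ?_))
    exact div_ne_zero (h2 i) (mul_ne_zero hW.ne' h1)
  have hmain := relEntropy_nonneg hp hq hq1 hpq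
  have hterm : ∀ x m, p (x, m) * Real.logb 2 (p (x, m) / q (x, m))
      = κ x m * Real.logb 2 (κ x m / Q m) / Fintype.card (ι → W)
        - ∑ i, κ x m * Real.logb 2 (coordChan κ i (x i) m / Q m) / Fintype.card (ι → W) := by
    intro x m
    rcases eq_or_ne (κ x m) 0 with h | h
    · simp [p, h]
    obtain ⟨h1, h2⟩ := hpos x m h
    have e : p (x, m) / q (x, m) = (κ x m / Q m) / ∏ i, (coordChan κ i (x i) m / Q m) := by
      have e2 : ∏ i, (coordChan κ i (x i) m / (Fintype.card W * Q m))
          = (∏ i, (coordChan κ i (x i) m / Q m)) / Fintype.card (ι → W) := by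
        rw [hKW, ← prod_div_distrib]
        exact prod_congr rfl fun i _ => by rw [mul_comm, div_div]
      have h3 : ∏ i, (coordChan κ i (x i) m / Q m) ≠ 0 :=
        prod_ne_zero_iff.2 fun i _ => div_ne_zero (h2 i) h1
      simp only [p, q, e2]
      field_simp
    rw [e, Real.logb_div (div_ne_zero h h1)
      (prod_ne_zero_iff.2 fun i _ => div_ne_zero (h2 i) h1),
      Real.logb_prod _ _ fun i _ => div_ne_zero (h2 i) h1, ← sum_div, ← mul_sum]
    simp only [p]
    ring
  simp only [relEntropy, Fintype.sum_prod_type, hterm, sum_sub_distrib] at hmain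
  have e1 : ∑ x, ∑ m, κ x m * Real.logb 2 (κ x m / Q m) / Fintype.card (ι → W)
      = chanInfo κ := by
    simp only [chanInfo, relEntropy, sum_div, hQdef]
  have e2 : ∑ x, ∑ m, ∑ i, κ x m * Real.logb 2 (coordChan κ i (x i) m / Q m) /
      Fintype.card (ι → W) = ∑ i, chanInfo (coordChan κ i) := by
    simp only [hcoord, sum_div]
    rw [sum_comm (s := (univ : Finset ι))]
    exact sum_congr rfl fun x _ => sum_comm
  linarith

end Info

/-! ### Compression of messages by sampling -/

section Compression

variable {M I S T : Type*} [Fintype M] [Fintype I] [Fintype S] [Fintype T]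

/-- The messages whose probability under `p` is at most `K` times that under `q` carry almost all
of the mass of `p`. -/
theorem one_sub_le_sum_filter_le_mul {p q : M → ℝ} (hp : p ∈ stdSimplex ℝ M)
    (hq : q ∈ stdSimplex ℝ M) (hpq : ∀ m, q m = 0 → p m = 0) {d ε : ℝ} (hd : 0 ≤ d)
    (hD : relEntropy p q ≤ d) (hε : 0 < ε) :
    1 - ε ≤ ∑ m with p m ≤ (2 : ℝ) ^ ((d + 1) / ε) * q m, p m := by
  set k := (d + 1) / ε with hk
  have hk0 : 0 < k := by positivity
  have hl : 0.69 < Real.log 2 := by have := Real.log_two_gt_d9; linarith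
  have hl' : Real.log 2 < 0.7 := by have := Real.log_two_lt_d9; linarith
  -- Off the good set the log-ratio is at least `k`. On it, `log t ≤ t / 2` and `2 * log 2 > 1` give
  -- a term of at least `-q m`. The negative terms thus cost at most 1 in total, which is the 1 in
  -- `d + 1`.
  have hterm : ∀ m, k * (if p m ≤ (2 : ℝ) ^ k * q m then 0 else p m) - q m
      ≤ p m * Real.logb 2 (p m / q m) := by
    intro m
    rcases (hp.1 m).eq_or_lt with h0 | h0
    · simp [← h0, hq.1 m]
    have hq0 : 0 < q m := lt_of_le_of_ne (hq.1 m) fun h => h0.ne' (hpq m h.symm)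
    split_ifs with h
    · rw [Real.logb, ← mul_div_assoc, le_div_iff₀ (by linarith), ← inv_div (q m), Real.log_inv]
      have h1 := Real.log_le_sub_one_of_pos (show 0 < q m / p m / 2 by positivity)
      rw [Real.log_div (by positivity) (by norm_num)] at h1
      have h2 : p m * (q m / p m) = q m := by field_simp
      have h3 : p m * Real.log (q m / p m) ≤ p m * (q m / p m / 2) :=
        mul_le_mul_of_nonneg_left (by linarith) h0.le
      nlinarith
    · have h1 : k ≤ Real.logb 2 (p m / q m) := by
        rw [Real.le_logb_iff_rpow_le (by norm_num) (by positivity), le_div_iff₀ hq0]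
        exact (not_le.1 h).le
      nlinarith
  have hsum := sum_le_sum fun m (_ : m ∈ univ) => hterm m
  rw [sum_sub_distrib, ← mul_sum, hq.2] at hsum
  have hB : k * ∑ m, (if p m ≤ (2 : ℝ) ^ k * q m then 0 else p m) ≤ d + 1 := by
    unfold relEntropy at hD; linarith
  have hB' : ∑ m, (if p m ≤ (2 : ℝ) ^ k * q m then 0 else p m) ≤ ε := by
    have : d + 1 = k * ε := by rw [hk]; field_simp
    rw [this] at hB
    exact le_of_mul_le_mul_left hB hk0
  have htot : ∑ m with p m ≤ (2 : ℝ) ^ k * q m, p m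
      + ∑ m, (if p m ≤ (2 : ℝ) ^ k * q m then 0 else p m) = 1 := by
    rw [sum_filter, ← sum_add_distrib, ← hp.2]
    exact sum_congr rfl fun m _ => by split_ifs <;> simp
  linarith

open Classical in
/-- Acceptance probability in rejection sampling of `p` from `K * q`. -/
noncomputable def acceptProb {α : Type*} (p q : α → ℝ) (K : ℝ) (m : α) : ℝ :=
  if p m ≤ K * q m then p m / (K * q m) else 0

theorem acceptProb_nonneg {α : Type*} {p q : α → ℝ} (hp : ∀ m, 0 ≤ p m) (hq : ∀ m, 0 ≤ q m) {K : ℝ}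
    (hK : 0 < K) (m : α) : 0 ≤ acceptProb p q K m := by
  have := hp m; have := hq m
  unfold acceptProb; split_ifs <;> positivity

theorem acceptProb_le_one {α : Type*} {p q : α → ℝ} (hp : ∀ m, 0 ≤ p m) (hq : ∀ m, 0 ≤ q m) {K : ℝ}
    (hK : 0 < K) (m : α) : acceptProb p q K m ≤ 1 := by
  have := hp m; have := hq m
  unfold acceptProb
  split_ifs with h
  · exact div_le_one_of_le₀ h (by positivity)
  · norm_num

-- Proposing from `q` and accepting produces `m` with probability `p m / K` on the good set: the
-- accepted sample follows the truncated `p`.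
open Classical in
theorem mul_acceptProb {α : Type*} {p q : α → ℝ} (hp : ∀ m, 0 ≤ p m) {K : ℝ}
    (hK : 0 < K) (m : α) :
    q m * acceptProb p q K m = (if p m ≤ K * q m then p m else 0) / K := by
  unfold acceptProb
  split_ifs with h
  · rcases eq_or_ne (q m) 0 with h0 | h0
    · have : p m = 0 := le_antisymm (by simpa [h0] using h) (hp m)
      simp [h0, this]
    · field_simp
  · simp

/-- Exponential moment of the excess of a weighted test over its target. -/
theorem sum_mul_exp_acceptProb_le {p q h : M → ℝ} (hp : p ∈ stdSimplex ℝ M)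
    (hq : q ∈ stdSimplex ℝ M) (hh0 : ∀ m, 0 ≤ h m) (hh1 : ∀ m, h m ≤ 1) {K ε : ℝ} (hK : 0 < K)
    (hε : 0 < ε) (hε1 : ε < 1) (hgood : 1 - ε ≤ ∑ m with p m ≤ K * q m, p m)
    (hc : ∑ m, p m * h m + 2 * ε ≤ 1) :
    ∑ m, q m * Real.exp (ε / 2 * (acceptProb p q K m * (h m - (∑ m, p m * h m + 2 * ε))))
      ≤ Real.exp (-((1 - ε) * ε ^ 2 / (4 * K))) := by
  classical
  set a := ∑ m, p m * h m with ha
  set w := acceptProb p q K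
  set p' : M → ℝ := fun m => if p m ≤ K * q m then p m else 0 with hp'
  set ρ := ∑ m, p' m with hρ
  have hw0 : ∀ m, 0 ≤ w m := acceptProb_nonneg hp.1 hq.1 hK
  have hw1 : ∀ m, w m ≤ 1 := acceptProb_le_one hp.1 hq.1 hK
  have hqw : ∀ m, q m * w m = p' m / K := mul_acceptProb hp.1 hK
  have hp'0 : ∀ m, 0 ≤ p' m := fun m => by simp only [hp']; split_ifs <;> simp [hp.1 m]
  have hp'p : ∀ m, p' m ≤ p m := fun m => by simp only [hp']; split_ifs <;> simp [hp.1 m]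
  have hρε : 1 - ε ≤ ρ := by rwa [sum_filter] at hgood
  have ha0 : 0 ≤ a := sum_nonneg fun m _ => mul_nonneg (hp.1 m) (hh0 m)
  -- Truncation raises the conditional mean of `h` by at most `ε`, leaving a margin `ε` below the
  -- target `a + 2 * ε`.
  have hp'h : ∑ m, p' m * h m ≤ (a + ε) * ρ := by
    have h1 : ∑ m, p' m * h m ≤ a :=
      sum_le_sum fun m _ => mul_le_mul_of_nonneg_right (hp'p m) (hh0 m)
    nlinarith [mul_nonneg (add_nonneg ha0 hε.le) (sub_nonneg.2 hρε),
      mul_nonneg hε.le (show 0 ≤ 1 - a - ε by linarith)]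
  -- From `exp t ≤ 1 + t + t ^ 2` for `|t| ≤ 1`. Since `w ^ 2 ≤ w`, the quadratic term is also a
  -- multiple of `p' m / K`. The tilt `ε / 2` minimizes `-λ * ε + λ ^ 2`.
  have hterm : ∀ m, q m * Real.exp (ε / 2 * (w m * (h m - (a + 2 * ε))))
      ≤ q m + ε / 2 * (p' m / K) * (h m - (a + 2 * ε)) + ε ^ 2 / 4 * (p' m / K) := by
    intro m
    set y := h m - (a + 2 * ε)
    have hy : |y| ≤ 1 := abs_le.2 ⟨by linarith [hh0 m], by linarith [hh1 m]⟩
    have hy2 : y ^ 2 ≤ 1 := by rw [← sq_abs]; exact pow_le_one₀ (abs_nonneg _) hy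
    have ht : |ε / 2 * (w m * y)| ≤ 1 := by
      rw [abs_mul, abs_mul, abs_of_nonneg (hw0 m), abs_of_pos (by positivity)]
      have : w m * |y| ≤ 1 := mul_le_one₀ (hw1 m) (abs_nonneg _) hy
      have := mul_nonneg (hw0 m) (abs_nonneg y)
      nlinarith
    have he := (abs_le.1 (Real.abs_exp_sub_one_sub_id_le ht)).2
    have hsq : (ε / 2 * (w m * y)) ^ 2 ≤ ε ^ 2 / 4 * w m := by
      have e : (ε / 2 * (w m * y)) ^ 2 = ε ^ 2 / 4 * (w m * (w m * y ^ 2)) := by ring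
      rw [e]
      refine mul_le_mul_of_nonneg_left ?_ (by positivity)
      exact mul_le_of_le_one_right (hw0 m) (mul_le_one₀ (hw1 m) (sq_nonneg _) hy2)
    calc q m * Real.exp (ε / 2 * (w m * y))
        ≤ q m * (1 + ε / 2 * (w m * y) + ε ^ 2 / 4 * w m) :=
          mul_le_mul_of_nonneg_left (by linarith) (hq.1 m)
      _ = q m + ε / 2 * (q m * w m) * y + ε ^ 2 / 4 * (q m * w m) := by ring
      _ = _ := by rw [hqw]
  have hlin : ∑ m, (q m + ε / 2 * (p' m / K) * (h m - (a + 2 * ε)) + ε ^ 2 / 4 * (p' m / K))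
      = 1 + ε / (2 * K) * (∑ m, p' m * h m - (a + 2 * ε) * ρ) + ε ^ 2 / (4 * K) * ρ := by
    rw [← hq.2, hρ, mul_sum, mul_sum, ← sum_sub_distrib, mul_sum, ← sum_add_distrib,
      ← sum_add_distrib]
    exact sum_congr rfl fun m _ => by field_simp
  refine (sum_le_sum fun m _ => hterm m).trans ?_
  rw [hlin]
  have h1 : ε / (2 * K) * (∑ m, p' m * h m - (a + 2 * ε) * ρ) ≤ ε / (2 * K) * (-(ε * ρ)) :=
    mul_le_mul_of_nonneg_left (by linarith) (by positivity)
  have h2 : ε / (2 * K) * (-(ε * ρ)) + ε ^ 2 / (4 * K) * ρ = -(ρ * ε ^ 2 / (4 * K)) := by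
    field_simp; ring
  have h3 : (1 - ε) * ε ^ 2 / (4 * K) ≤ ρ * ε ^ 2 / (4 * K) := by gcongr
  have h4 := Real.add_one_le_exp (-((1 - ε) * ε ^ 2 / (4 * K)))
  linarith

/-- Some list of samples from `q` makes every weighted test with a nontrivial target fall short
of it. -/
theorem exists_samples {p : S → M → ℝ} {q : M → ℝ} {h : S → T → M → ℝ}
    (hp : ∀ x, p x ∈ stdSimplex ℝ M) (hq : q ∈ stdSimplex ℝ M) (hh0 : ∀ x t m, 0 ≤ h x t m)
    (hh1 : ∀ x t m, h x t m ≤ 1) {K ε : ℝ} (hK : 0 < K) (hε : 0 < ε) (hε1 : ε < 1)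
    (hgood : ∀ x, 1 - ε ≤ ∑ m with p x m ≤ K * q m, p x m) {n : ℕ}
    (hST : Fintype.card S * Fintype.card T ≤ 4 ^ n)
    (hI : 8 * (n + 1) * K / (ε ^ 2 * (1 - ε)) ≤ Fintype.card I) :
    ∃ s : I → M, ∀ x t, ∑ m, p x m * h x t m + 2 * ε ≤ 1 →
      ∑ i, acceptProb (p x) q K (s i) * (h x t (s i) - (∑ m, p x m * h x t m + 2 * ε)) < 0 := by
  classical
  by_contra! hbad
  set c : S → T → ℝ := fun x t => ∑ m, p x m * h x t m + 2 * ε with hc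
  set Z : S → T → M → ℝ := fun x t m => acceptProb (p x) q K m * (h x t m - c x t) with hZ
  set E : S × T → M → ℝ := fun a m => Real.exp (ε / 2 * Z a.1 a.2 m) with hE
  let G : Finset (S × T) := {a | c a.1 a.2 ≤ 1}
  -- Union bound in exponential form: every list fails some test, whose exponential is then at least
  -- 1. Independence of the samples turns the sum over lists into a power.
  have h1 : (1 : ℝ) ≤ ∑ a ∈ G, (∑ m, q m * E a m) ^ Fintype.card I := by
    have hs : ∀ F : M → ℝ, (∑ m, F m) ^ Fintype.card I = ∑ s : I → M, ∏ i, F (s i) := by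
      intro F
      rw [← Fintype.prod_sum (fun (_ : I) m => F m)]
      simp
    calc (1 : ℝ) = ∑ s : I → M, ∏ i, q (s i) := by rw [← hs, hq.2, one_pow]
      _ ≤ ∑ s : I → M, ∑ a ∈ G, ∏ i, (q (s i) * E a (s i)) := by
          refine sum_le_sum fun s _ => ?_
          obtain ⟨x, t, hct, hsum⟩ := hbad s
          have hq0 : 0 ≤ ∏ i, q (s i) := prod_nonneg fun i _ => hq.1 _
          have hone : 1 ≤ ∏ i, E (x, t) (s i) := by
            simp only [hE]
            rw [← Real.exp_sum, ← mul_sum]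
            exact Real.one_le_exp (mul_nonneg (by positivity) hsum)
          calc ∏ i, q (s i) ≤ ∏ i, (q (s i) * E (x, t) (s i)) := by
                rw [prod_mul_distrib]; exact le_mul_of_one_le_right hq0 hone
            _ ≤ _ := single_le_sum (f := fun a => ∏ i, (q (s i) * E a (s i)))
                (fun a _ => prod_nonneg fun i _ => mul_nonneg (hq.1 _) (Real.exp_pos _).le)
                (by simpa [G] using hct)
      _ = _ := by rw [sum_comm]; exact sum_congr rfl fun a _ => (hs fun m => q m * E a m).symm
  -- The list length times the Chernoff exponent is at least `2 * (n + 1)`, which beats the `4 ^ n`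
  -- tests because `exp 2 > 4`.
  have h2 : ∀ a ∈ G, (∑ m, q m * E a m) ^ Fintype.card I ≤ Real.exp (-(2 * (n + 1))) := by
    intro a ha
    have ha' : c a.1 a.2 ≤ 1 := by simpa [G] using ha
    have hb := sum_mul_exp_acceptProb_le (hp a.1) hq (hh0 a.1 a.2) (hh1 a.1 a.2) hK hε hε1
      (hgood a.1) ha'
    refine (pow_le_pow_left₀ (sum_nonneg fun m _ =>
      mul_nonneg (hq.1 _) (Real.exp_pos _).le) hb _).trans ?_
    rw [← Real.exp_nat_mul]
    refine Real.exp_le_exp.2 ?_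
    have hε' : 0 < 1 - ε := by linarith
    have : 8 * (n + 1) * K / (ε ^ 2 * (1 - ε)) * ((1 - ε) * ε ^ 2 / (4 * K)) = 2 * (n + 1) := by
      field_simp; ring
    have h3 := mul_le_mul_of_nonneg_right hI
      (show 0 ≤ (1 - ε) * ε ^ 2 / (4 * K) by positivity)
    linarith
  have h3 : (1 : ℝ) ≤ 4 ^ n * Real.exp (-(2 * (n + 1))) := by
    refine h1.trans ((sum_le_sum h2).trans ?_)
    rw [sum_const, nsmul_eq_mul]
    refine mul_le_mul_of_nonneg_right ?_ (Real.exp_pos _).le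
    have : G.card ≤ 4 ^ n := (card_le_univ G).trans (by rwa [Fintype.card_prod])
    exact_mod_cast this
  have h4 : (4 : ℝ) ^ n < Real.exp (2 * (n + 1)) := by
    have he : (4 : ℝ) < Real.exp 2 := by
      have := Real.exp_one_gt_d9
      rw [show (2 : ℝ) = 1 + 1 by norm_num, Real.exp_add]
      nlinarith
    calc (4 : ℝ) ^ n < 4 ^ (n + 1) := pow_lt_pow_right₀ (by norm_num) (by omega)
      _ ≤ Real.exp 2 ^ (n + 1) := pow_le_pow_left₀ (by norm_num) he.le _
      _ = _ := by rw [← Real.exp_nat_mul]; push_cast; ring_nf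
  rw [Real.exp_neg, ← div_eq_mul_inv, le_div_iff₀ (Real.exp_pos _)] at h3
  linarith

/-- Message compression: a family of message distributions of small relative entropy to a common
distribution can be replaced by distributions on a short list of messages, with little effect on
any of the given tests. -/
theorem exists_compression [Nonempty I] {p : S → M → ℝ} {q : M → ℝ} {h : S → T → M → ℝ}
    (hp : ∀ x, p x ∈ stdSimplex ℝ M) (hq : q ∈ stdSimplex ℝ M)
    (hpq : ∀ x m, q m = 0 → p x m = 0) (hh0 : ∀ x t m, 0 ≤ h x t m)
    (hh1 : ∀ x t m, h x t m ≤ 1) {d ε : ℝ} (hd : 0 ≤ d) (hD : ∀ x, relEntropy (p x) q ≤ d)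
    (hε : 0 < ε) (hε1 : ε < 1) {n : ℕ} (hST : Fintype.card S * Fintype.card T ≤ 4 ^ n)
    (hI : 8 * (n + 1) * (2 : ℝ) ^ ((d + 1) / ε) / (ε ^ 2 * (1 - ε)) ≤ Fintype.card I) :
    ∃ (s : I → M) (r : S → I → ℝ), (∀ x, r x ∈ stdSimplex ℝ I) ∧
      ∀ x t, ∑ i, r x i * h x t (s i) ≤ ∑ m, p x m * h x t m + 2 * ε := by
  classical
  have hK : (0 : ℝ) < 2 ^ ((d + 1) / ε) := by positivity
  obtain ⟨s, hs⟩ := exists_samples (I := I) hp hq hh0 hh1 hK hε hε1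
    (fun x => one_sub_le_sum_filter_le_mul (hp x) hq (hpq x) hd (hD x) hε) hST hI
  set K := (2 : ℝ) ^ ((d + 1) / ε)
  have hw0 : ∀ x m, 0 ≤ acceptProb (p x) q K m := fun x =>
    acceptProb_nonneg (hp x).1 hq.1 hK
  let A : S → ℝ := fun x => ∑ i, acceptProb (p x) q K (s i)
  have hA : ∀ x, 0 ≤ A x := fun x => sum_nonneg fun i _ => hw0 x _
  have hN : (0 : ℝ) < Fintype.card I := by positivity
  -- If no sample is accepted the index is uniform. This occurs only when every target of `x`
  -- exceeds 1, where any distribution will do.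
  refine ⟨s, fun x i => if A x = 0 then (Fintype.card I : ℝ)⁻¹
    else acceptProb (p x) q K (s i) / A x, fun x => ?_, fun x t => ?_⟩
  · by_cases hx : A x = 0
    · simp only [hx, if_true]
      exact ⟨fun _ => by positivity, by simp⟩
    · simp only [hx, if_false]
      exact ⟨fun i => div_nonneg (hw0 x _) (hA x), by rw [← sum_div]; exact div_self hx⟩
  · by_cases hc : ∑ m, p x m * h x t m + 2 * ε ≤ 1
    · have hst := hs x t hc
      simp only [mul_sub, sum_sub_distrib, ← sum_mul] at hst
      -- Strictness in `exists_samples` is used here: with no accepted sample the sum would be 0.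
      have hx : A x ≠ 0 := by
        intro hx
        have : ∀ i, acceptProb (p x) q K (s i) = 0 := fun i =>
          (sum_eq_zero_iff_of_nonneg fun i _ => hw0 x _).1 hx i (mem_univ i)
        simp [this] at hst
      simp only [hx, if_false, div_mul_eq_mul_div, ← sum_div]
      rw [div_le_iff₀ ((hA x).lt_of_ne' hx), mul_comm]
      change _ ≤ A x * _
      change _ - A x * _ < 0 at hst
      linarith
    · refine le_trans ?_ (not_le.1 hc).le
      by_cases hx : A x = 0
      · simp only [hx, if_true]
        calc _ ≤ ∑ _i : I, (Fintype.card I : ℝ)⁻¹ := sum_le_sum fun i _ =>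
              mul_le_of_le_one_right (by positivity) (hh1 x t _)
          _ = 1 := by simp
      · simp only [hx, if_false]
        calc _ ≤ ∑ i, acceptProb (p x) q K (s i) / A x := sum_le_sum fun i _ =>
              mul_le_of_le_one_right (div_nonneg (hw0 x _) (hA x)) (hh1 x t _)
          _ = 1 := by rw [← sum_div]; exact div_self hx

/-- At least two thirds of the inputs have relative entropy at most three times the average. -/
theorem card_filter_relEntropy_le {W : Type*} [Fintype W] [Nonempty W] {κ : W → M → ℝ}
    (hκ : ∀ w, κ w ∈ stdSimplex ℝ M) :
    (2 / 3 : ℝ) * Fintype.card W ≤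
      (univ.filter fun w => relEntropy (κ w) (chanAvg κ) ≤ 3 * chanInfo κ).card := by
  have hD := relEntropy_chanAvg_nonneg hκ
  have hW : (0 : ℝ) < Fintype.card W := by positivity
  have hsum : ∑ w, relEntropy (κ w) (chanAvg κ) = chanInfo κ * Fintype.card W := by
    rw [chanInfo]; field_simp
  -- Markov's inequality divides by the information; when that is 0, all the relative entropies
  -- vanish.
  rcases (chanInfo_nonneg hκ).eq_or_lt with h0 | h0
  · rw [← h0, zero_mul, sum_eq_zero_iff_of_nonneg fun w _ => hD w] at hsum
    have : (univ.filter fun w => relEntropy (κ w) (chanAvg κ) ≤ 3 * chanInfo κ) = univ := by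
      ext w; simp [hsum w (mem_univ w), ← h0]
    rw [this, card_univ]; linarith
  · have hbad : (univ.filter fun w => ¬relEntropy (κ w) (chanAvg κ) ≤ 3 * chanInfo κ).card
        * (3 * chanInfo κ) ≤ chanInfo κ * Fintype.card W := by
      rw [← hsum, ← nsmul_eq_mul]
      refine (card_nsmul_le_sum _ _ _ fun w hw => ?_).trans
        (sum_le_univ_sum_of_nonneg hD)
      exact (not_le.1 (mem_filter.1 hw).2).le
    have hc := card_filter_add_card_filter_not (s := (univ : Finset W))
      (fun w => relEntropy (κ w) (chanAvg κ) ≤ 3 * chanInfo κ)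
    rw [card_univ] at hc
    have hc' : ((univ.filter fun w => relEntropy (κ w) (chanAvg κ) ≤ 3 * chanInfo κ).card : ℝ)
      + (univ.filter fun w => ¬relEntropy (κ w) (chanAvg κ) ≤ 3 * chanInfo κ).card
      = Fintype.card W := by exact_mod_cast hc
    have : (univ.filter fun w => ¬relEntropy (κ w) (chanAvg κ) ≤ 3 * chanInfo κ).card * 3
        ≤ (Fintype.card W : ℝ) := by
      refine le_of_mul_le_mul_right ?_ h0
      linarith
    linarith

end Compression

/-! ### Distributions of protocols as real functions -/

section Distributions

variable {M W : Type*} [Fintype M] [Fintype W]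

theorem PMF.toReal_mem_stdSimplex (p : PMF M) : (fun m => (p m).toReal) ∈ stdSimplex ℝ M := by
  refine ⟨fun m => ENNReal.toReal_nonneg, ?_⟩
  rw [← ENNReal.toReal_sum fun m _ => p.apply_ne_top m, ← tsum_fintype (L := .unconditional _),
    p.tsum_coe, ENNReal.toReal_one]

/-- The distribution given by a point of the standard simplex. -/
noncomputable def pmfOfSimplex (p : M → ℝ) (hp : p ∈ stdSimplex ℝ M) : PMF M :=
  PMF.ofFintype (fun m => ENNReal.ofReal (p m)) (by
    rw [← ENNReal.ofReal_sum_of_nonneg fun m _ => hp.1 m, hp.2, ENNReal.ofReal_one])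

theorem pmfOfSimplex_toReal (p : M → ℝ) (hp : p ∈ stdSimplex ℝ M) (m : M) :
    (pmfOfSimplex p hp m).toReal = p m :=
  ENNReal.toReal_ofReal (hp.1 m)

theorem bind_map_prodMk_apply (μ : PMF W) (κ : W → PMF M) (w : W) (m : M) :
    (μ.bind fun w => (κ w).map fun m => (w, m)) (w, m) = μ w * κ w m := by
  classical
  have h : ∀ w', ((κ w').map fun m => (w', m)) (w, m) = if w' = w then κ w m else 0 := by
    intro w'
    rw [PMF.map_apply, tsum_fintype]
    split_ifs with h
    · subst h
      simp
    · exact sum_eq_zero fun m' _ => if_neg fun e => h (Prod.mk.inj e).1.symm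
  rw [PMF.bind_apply, tsum_fintype]
  simp [h]

theorem PMF.toReal_uniformOfFintype_bind {V α : Type*} [Fintype V] [Nonempty V] (κ : V → PMF α)
    (u : α) :
    (((PMF.uniformOfFintype V).bind κ) u).toReal = (∑ z, (κ z u).toReal) / Fintype.card V := by
  rw [PMF.bind_apply, tsum_fintype, ENNReal.toReal_sum fun w _ =>
    ENNReal.mul_ne_top (PMF.apply_ne_top _ _) (PMF.apply_ne_top _ _)]
  simp [div_eq_inv_mul, mul_sum]

theorem shannonEntropy_uniform [Nonempty W] :
    shannonEntropy (PMF.uniformOfFintype W) = Real.logb 2 (Fintype.card W) := by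
  simp [shannonEntropy, Real.logb_inv]

/-- With a uniform input, mutual information is the average relative entropy to the output
distribution. -/
theorem mutualInfo_uniform_bind [Nonempty W] (κ : W → PMF M) :
    mutualInfo ((PMF.uniformOfFintype W).bind fun w => (κ w).map fun m => (w, m))
      = chanInfo fun w m => (κ w m).toReal := by
  have hκ : ∀ w, (fun m => (κ w m).toReal) ∈ stdSimplex ℝ M := fun w => (κ w).toReal_mem_stdSimplex
  have hW : (0 : ℝ) < Fintype.card W := by positivity
  set Q := chanAvg fun w m => (κ w m).toReal with hQ
  have hfst : ((PMF.uniformOfFintype W).bind fun w => (κ w).map fun m => (w, m)).map Prod.fst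
      = PMF.uniformOfFintype W := by
    rw [PMF.map_bind]
    simp only [PMF.map_comp]
    have : ∀ w, PMF.map (Prod.fst ∘ fun m => (w, m)) (κ w) = PMF.pure w := fun w =>
      PMF.map_const _ _
    simp only [this, PMF.bind_pure]
  have hsnd : ((PMF.uniformOfFintype W).bind fun w => (κ w).map fun m => (w, m)).map Prod.snd
      = (PMF.uniformOfFintype W).bind κ := by
    rw [PMF.map_bind]
    simp only [PMF.map_comp]
    have : ∀ w, PMF.map (Prod.snd ∘ fun m => (w, m)) (κ w) = κ w := fun w => PMF.map_id _
    simp only [this]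
  have havg : ∀ m, (((PMF.uniformOfFintype W).bind κ) m).toReal = Q m :=
    PMF.toReal_uniformOfFintype_bind κ
  rw [mutualInfo, hfst, hsnd, shannonEntropy_uniform]
  simp only [shannonEntropy, havg, Fintype.sum_prod_type, bind_map_prodMk_apply,
    ENNReal.toReal_mul, PMF.uniformOfFintype_apply, ENNReal.toReal_inv, ENNReal.toReal_natCast]
  have e1 : ∑ m, Q m * Real.logb 2 (Q m)
      = ∑ w, ∑ m, (Fintype.card W : ℝ)⁻¹ * (κ w m).toReal * Real.logb 2 (Q m) := by
    rw [sum_comm]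
    refine sum_congr rfl fun m _ => ?_
    rw [← sum_mul, ← mul_sum, hQ, chanAvg, div_eq_inv_mul]
  have e2 : Real.logb 2 (Fintype.card W) = ∑ w, ∑ m, (Fintype.card W : ℝ)⁻¹ * (κ w m).toReal *
      Real.logb 2 (Fintype.card W) := by
    simp only [← sum_mul, ← mul_sum, (hκ _).2]
    simp
  rw [e1]
  nth_rw 1 [e2]
  rw [chanInfo, sum_div, ← sub_eq_add_neg, sub_neg_eq_add, ← sum_sub_distrib, ← sum_add_distrib]
  refine sum_congr rfl fun w _ => ?_
  rw [relEntropy, sum_div, ← sum_sub_distrib, ← sum_add_distrib]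
  refine sum_congr rfl fun m _ => ?_
  rcases eq_or_ne (κ w m).toReal 0 with h | h
  · simp [h]
  have hq : Q m ≠ 0 := fun e => h (eq_zero_of_chanAvg_eq_zero hκ e w)
  rw [Real.logb_mul (by positivity) h, Real.logb_inv, Real.logb_div h hq]
  field_simp
  ring

end Distributions

/-! ### Error and information cost in terms of message probabilities -/

namespace SimProtocol

variable {X Y Z : Type*}

/-- Alice's message probabilities. -/
noncomputable def aliceProb (P : SimProtocol X Y Z) (x : X) (u : Fin P.lenA → Bool) : ℝ :=
  (P.alice x u).toReal

/-- Bob's message probabilities. -/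
noncomputable def bobProb (P : SimProtocol X Y Z) (y : Y) (v : Fin P.lenB → Bool) : ℝ :=
  (P.bob y v).toReal

theorem aliceProb_mem (P : SimProtocol X Y Z) (x : X) :
    P.aliceProb x ∈ stdSimplex ℝ (Fin P.lenA → Bool) := (P.alice x).toReal_mem_stdSimplex

theorem bobProb_mem (P : SimProtocol X Y Z) (y : Y) :
    P.bobProb y ∈ stdSimplex ℝ (Fin P.lenB → Bool) := (P.bob y).toReal_mem_stdSimplex

theorem transcript_toReal (P : SimProtocol X Y Z) (x : X) (y : Y)
    (t : (Fin P.lenA → Bool) × (Fin P.lenB → Bool)) :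
    (P.transcript x y t).toReal = P.aliceProb x t.1 * P.bobProb y t.2 := by
  rw [aliceProb, bobProb, ← ENNReal.toReal_mul]
  exact congrArg _ (bind_map_prodMk_apply (P.alice x) (fun _ => P.bob y) t.1 t.2)

open Classical in
theorem probOutput_eq (P : SimProtocol X Y Z) (x : X) (y : Y) (z : Z) :
    P.probOutput x y z
      = ∑ u, ∑ v, P.aliceProb x u * P.bobProb y v * if P.referee u v = z then 1 else 0 := by
  simp only [probOutput, transcript_toReal, Fintype.sum_prod_type, mul_ite, mul_one, mul_zero]

open Classical in
/-- The error probability on an input. -/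
theorem one_sub_probOutput (P : SimProtocol X Y Z) (x : X) (y : Y) (z : Z) :
    1 - P.probOutput x y z
      = ∑ u, P.aliceProb x u * ∑ v, P.bobProb y v * if P.referee u v = z then 0 else 1 := by
  have h : ∑ u, ∑ v, P.aliceProb x u * P.bobProb y v = 1 := by
    simp only [← mul_sum, (P.bobProb_mem y).2, (P.aliceProb_mem x).2, mul_one]
  rw [probOutput_eq]
  nth_rw 1 [← h]
  rw [← sum_sub_distrib]
  refine sum_congr rfl fun u _ => ?_
  rw [← sum_sub_distrib, mul_sum]
  exact sum_congr rfl fun v _ => by split_ifs <;> ring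

/-- The information cost splits between the two players. -/
theorem infoCost_uniform [Fintype X] [Nonempty X] [Fintype Y] [Nonempty Y]
    (P : SimProtocol X Y Z) :
    P.infoCost (PMF.uniformOfFintype (X × Y)) = chanInfo P.aliceProb + chanInfo P.bobProb := by
  rw [← chanInfo_prodChan P.aliceProb_mem P.bobProb_mem, infoCost, joint, mutualInfo_uniform_bind]
  congr 1
  funext xy t
  exact P.transcript_toReal xy.1 xy.2 t

theorem infoCost_uniform_le_cost [Fintype X] [Nonempty X] [Fintype Y] [Nonempty Y]
    (P : SimProtocol X Y Z) : P.infoCost (PMF.uniformOfFintype (X × Y)) ≤ P.cost := by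
  rw [infoCost_uniform, cost, Nat.cast_add]
  refine add_le_add ((chanInfo_le_logb_card P.aliceProb_mem).trans_eq ?_)
    ((chanInfo_le_logb_card P.bobProb_mem).trans_eq ?_) <;>
  simp [Real.logb_pow]

theorem exists_injective_bits (V : Type*) [Finite V] :
    ∃ (l : ℕ) (e : V → Fin l → Bool), Function.Injective e := by
  obtain ⟨k, ⟨e⟩⟩ := Finite.exists_equiv_fin V
  -- A one-hot code; its length is irrelevant, since only the existence of some protocol is needed.
  refine ⟨k, fun v j => decide (e v = j), fun v w h => e.injective ?_⟩
  have := congrFun h (e v)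
  simp only [decide_true] at this
  exact (of_decide_eq_true this.symm).symm

/-- Both players send their inputs, encoded in binary. -/
theorem exists_computes [Finite X] [Finite Y] [Nonempty X] [Nonempty Y] (f : X → Y → Z) {δ : ℝ}
    (hδ : 0 ≤ δ) : ∃ P : SimProtocol X Y Z, P.Computes f δ := by
  classical
  obtain ⟨k, a, ha⟩ := exists_injective_bits X
  obtain ⟨l, b, hb⟩ := exists_injective_bits Y
  refine ⟨⟨k, l, fun x => PMF.pure (a x), fun y => PMF.pure (b y),
    fun u v => f (Function.invFun a u) (Function.invFun b v)⟩, fun x y => ?_⟩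
  rw [probOutput_eq]
  have h1 : ∀ u, (PMF.pure (a x) u).toReal = if u = a x then 1 else 0 := by
    intro u; rw [PMF.pure_apply]; split_ifs <;> simp
  have h2 : ∀ u, (PMF.pure (b y) u).toReal = if u = b y then 1 else 0 := by
    intro u; rw [PMF.pure_apply]; split_ifs <;> simp
  simp only [aliceProb, bobProb, h1, h2]
  rw [Fintype.sum_eq_single (a x) fun u hu => by simp [hu],
    Fintype.sum_eq_single (b y) fun v hv => by simp [hv]]
  simp [Function.leftInverse_invFun ha x, Function.leftInverse_invFun hb y, hδ]

/-! ### The protocol obtained by embedding an input in one coordinate -/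

/-- Both players place their inputs in coordinate `i` and fill the remaining coordinates with
private uniform inputs; the referee announces coordinate `i` of the answer. -/
noncomputable def coord [Fintype X] [Nonempty X] [Fintype Y] [Nonempty Y] {m : ℕ}
    (P : SimProtocol (Fin m → X) (Fin m → Y) (Fin m → Z)) (i : Fin m) : SimProtocol X Y Z where
  lenA := P.lenA
  lenB := P.lenB
  alice x := (PMF.uniformOfFintype (Fin m → X)).bind fun z => P.alice (Function.update z i x)
  bob y := (PMF.uniformOfFintype (Fin m → Y)).bind fun z => P.bob (Function.update z i y)
  referee u v := P.referee u v i

variable [Fintype X] [Nonempty X] [Fintype Y] [Nonempty Y] {m : ℕ}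
  (P : SimProtocol (Fin m → X) (Fin m → Y) (Fin m → Z))

theorem aliceProb_coord (i : Fin m) : (P.coord i).aliceProb = coordChan P.aliceProb i := by
  funext x u
  exact PMF.toReal_uniformOfFintype_bind _ u

theorem bobProb_coord (i : Fin m) : (P.coord i).bobProb = coordChan P.bobProb i := by
  funext x u
  exact PMF.toReal_uniformOfFintype_bind _ u

/-- The error bound holds for every filling of the other coordinates, hence on average, and a
correct vector of answers is correct in coordinate `i`. -/
theorem computes_coord {f : X → Y → Z} {δ : ℝ} (hP : P.Computes (directSumFun m f) δ)
    (i : Fin m) : (P.coord i).Computes f δ := by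
  classical
  intro x y
  have hcard : (0 : ℝ) < Fintype.card (Fin m → X) * Fintype.card (Fin m → Y) := by positivity
  have hle : ∀ z w, 1 - δ ≤ ∑ u, ∑ v, P.aliceProb (Function.update z i x) u
      * P.bobProb (Function.update w i y) v * if P.referee u v i = f x y then 1 else 0 := by
    intro z w
    refine (hP (Function.update z i x) (Function.update w i y)).trans ?_
    rw [probOutput_eq]
    refine sum_le_sum fun u _ => sum_le_sum fun v _ => mul_le_mul_of_nonneg_left ?_
      (mul_nonneg ((P.aliceProb_mem _).1 u) ((P.bobProb_mem _).1 v))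
    split_ifs with h1 h2
    · exact le_rfl
    · exact absurd (by simp [h1, directSumFun]) h2
    · exact zero_le_one
    · exact le_rfl
  have e : (P.coord i).probOutput x y (f x y) = (∑ z, ∑ w, ∑ u, ∑ v,
      P.aliceProb (Function.update z i x) u * P.bobProb (Function.update w i y) v
        * if P.referee u v i = f x y then 1 else 0)
        / (Fintype.card (Fin m → X) * Fintype.card (Fin m → Y)) := by
    have e0 : (P.coord i).probOutput x y (f x y) = ∑ u, ∑ v, coordChan P.aliceProb i x u
        * coordChan P.bobProb i y v * if P.referee u v i = f x y then 1 else 0 := by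
      rw [probOutput_eq, aliceProb_coord, bobProb_coord]
      rfl
    rw [e0]
    have swap : ∀ F : (Fin m → X) → (Fin m → Y) → (Fin P.lenA → Bool) → (Fin P.lenB → Bool) → ℝ,
        ∑ z, ∑ w, ∑ u, ∑ v, F z w u v = ∑ u, ∑ v, ∑ z, ∑ w, F z w u v := by
      intro F
      calc _ = ∑ z, ∑ u, ∑ w, ∑ v, F z w u v := sum_congr rfl fun z _ => sum_comm
        _ = ∑ u, ∑ z, ∑ w, ∑ v, F z w u v := sum_comm
        _ = ∑ u, ∑ z, ∑ v, ∑ w, F z w u v :=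
          sum_congr rfl fun u _ => sum_congr rfl fun z _ => sum_comm
        _ = _ := sum_congr rfl fun u _ => sum_comm
    rw [swap, sum_div]
    refine Fintype.sum_congr _ _ fun u => ?_
    rw [sum_div]
    refine Fintype.sum_congr _ _ fun v => ?_
    rw [coordChan, coordChan, div_mul_div_comm, sum_mul_sum, div_mul_eq_mul_div, sum_mul]
    simp only [sum_mul]
  rw [e, le_div_iff₀ hcard]
  calc (1 - δ) * (Fintype.card (Fin m → X) * Fintype.card (Fin m → Y))
      = ∑ _z : Fin m → X, ∑ _w : Fin m → Y, (1 - δ) := by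
        simp only [sum_const, card_univ, nsmul_eq_mul]; ring
    _ ≤ _ := sum_le_sum fun z _ => sum_le_sum fun w _ => hle z w

theorem sum_infoCost_coord_le : ∑ i, (P.coord i).infoCost (PMF.uniformOfFintype (X × Y))
    ≤ P.infoCost (PMF.uniformOfFintype ((Fin m → X) × (Fin m → Y))) := by
  have h : ∀ i, (P.coord i).infoCost (PMF.uniformOfFintype (X × Y))
      = chanInfo (coordChan P.aliceProb i) + chanInfo (coordChan P.bobProb i) := by
    intro i
    rw [infoCost_uniform, aliceProb_coord, bobProb_coord]
    rfl
  rw [sum_congr rfl fun i _ => h i, sum_add_distrib, infoCost_uniform]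
  exact add_le_add (sum_chanInfo_coordChan_le P.aliceProb_mem)
    (sum_chanInfo_coordChan_le P.bobProb_mem)

end SimProtocol

/-! ### Compression of simultaneous message protocols -/

theorem Rsim_le_cost {X Y Z : Type*} {δ : ℝ} {f : X → Y → Z} {P : SimProtocol X Y Z}
    (hP : P.Computes f δ) : Rsim δ f ≤ P.cost :=
  Nat.sInf_le ⟨P, hP, rfl⟩

theorem isLarge_univ (n : ℕ) : IsLarge (univ : Finset (Fin n → Bool)) := by
  have : (0 : ℝ) < 2 ^ n := by positivity
  simp only [IsLarge, card_univ, Fintype.card_fun, Fintype.card_fin, Fintype.card_bool]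
  push_cast
  linarith

/-- A length for binary indices into a list of samples long enough for `exists_compression`. -/
theorem exists_length {n : ℕ} {a ε : ℝ} (ha : 0 ≤ a) (hε : 0 < ε) (hε1 : ε < 1) :
    ∃ l : ℕ, 8 * (n + 1) * (2 : ℝ) ^ ((3 * a + 1) / ε) / (ε ^ 2 * (1 - ε)) ≤
        Fintype.card (Fin l → Bool) ∧
      (l : ℝ) ≤ (3 * a + 1) / ε + Real.logb 2 (n + 1)
        + Real.logb 2 (1 / (ε ^ 2 * (1 - ε))) + 4 := by
  have hε' : 0 < 1 - ε := by linarith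
  have hden : 0 < ε ^ 2 * (1 - ε) := by positivity
  set t := 8 * (n + 1) * (2 : ℝ) ^ ((3 * a + 1) / ε) / (ε ^ 2 * (1 - ε)) with ht
  -- Makes the logarithm nonnegative, so that the natural-number ceiling adds less than 1. With
  -- `logb 2 8 = 3` this gives the constant 4 per player.
  have ht1 : 1 ≤ t := by
    rw [ht, le_div_iff₀ hden, one_mul]
    have h1 : (1 : ℝ) ≤ 2 ^ ((3 * a + 1) / ε) := Real.one_le_rpow (by norm_num) (by positivity)
    have h2 : ε ^ 2 * (1 - ε) ≤ 1 := mul_le_one₀ (by nlinarith) hε'.le (by linarith)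
    have h3 : (1 : ℝ) ≤ 8 * (n + 1) := by
      have : (0 : ℝ) ≤ n := Nat.cast_nonneg n
      linarith
    nlinarith
  have ht0 : 0 < t := by linarith
  have hlog : Real.logb 2 t = (3 * a + 1) / ε + Real.logb 2 (n + 1)
        + Real.logb 2 (1 / (ε ^ 2 * (1 - ε))) + 3 := by
    have h8 : Real.logb 2 8 = 3 := by
      rw [show (8 : ℝ) = 2 ^ (3 : ℕ) by norm_num, Real.logb_pow]; simp
    have hn : (n + 1 : ℝ) ≠ 0 := by positivity
    rw [ht, div_eq_mul_one_div, Real.logb_mul (by positivity) (by positivity),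
      Real.logb_mul (by positivity) (by positivity), Real.logb_mul (by norm_num) hn,
      Real.logb_rpow (by norm_num) (by norm_num), h8]
    ring
  refine ⟨⌈Real.logb 2 t⌉₊, ?_, ?_⟩
  · simp only [Fintype.card_fun, Fintype.card_fin, Fintype.card_bool, Nat.cast_pow,
      Nat.cast_ofNat]
    rw [← Real.rpow_natCast, ← Real.logb_le_iff_le_rpow (by norm_num) ht0]
    exact Nat.le_ceil _
  · have := Nat.ceil_lt_add_one (Real.logb_nonneg (by norm_num : (1 : ℝ) < 2) ht1)
    linarith

/-- A protocol of small information cost can be compressed, on a large rectangle of inputs, to a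
protocol of small communication cost. -/
theorem SimProtocol.exists_compressed {n : ℕ} {Z : Type*}
    {f : (Fin n → Bool) → (Fin n → Bool) → Z} {δ ε : ℝ} (hε : 0 < ε) (hε1 : ε < 1)
    (P : SimProtocol (Fin n → Bool) (Fin n → Bool) Z) (hP : P.Computes f δ) :
    ∃ A B : Finset (Fin n → Bool), IsLarge A ∧ IsLarge B ∧ ∃ P' : SimProtocol A B Z,
      P'.Computes (restrictRect f A B) (δ + 4 * ε) ∧
      (P'.cost : ℝ) ≤ 3 / ε * P.infoCost (PMF.uniformOfFintype ((Fin n → Bool) × (Fin n → Bool)))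
        + 2 * Real.logb 2 (n + 1) + 2 * Real.logb 2 (1 / (ε ^ 2 * (1 - ε))) + 2 / ε + 8 := by
  classical
  set a := chanInfo P.aliceProb with ha
  set b := chanInfo P.bobProb with hb
  have ha0 : 0 ≤ a := chanInfo_nonneg P.aliceProb_mem
  have hb0 : 0 ≤ b := chanInfo_nonneg P.bobProb_mem
  let A : Finset (Fin n → Bool) :=
    univ.filter fun x => relEntropy (P.aliceProb x) (chanAvg P.aliceProb) ≤ 3 * a
  let B : Finset (Fin n → Bool) :=
    univ.filter fun y => relEntropy (P.bobProb y) (chanAvg P.bobProb) ≤ 3 * b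
  have hA : IsLarge A := by simpa [IsLarge] using card_filter_relEntropy_le P.aliceProb_mem
  have hB : IsLarge B := by simpa [IsLarge] using card_filter_relEntropy_le P.bobProb_mem
  have hcard : ∀ S T : Finset (Fin n → Bool), Fintype.card S * Fintype.card T ≤ 4 ^ n := by
    intro S T
    have h : ∀ S : Finset (Fin n → Bool), Fintype.card S ≤ 2 ^ n := fun S => by
      simpa using card_le_univ S
    calc _ ≤ 2 ^ n * 2 ^ n := Nat.mul_le_mul (h S) (h T)
      _ = 4 ^ n := by rw [← mul_pow]; norm_num
  obtain ⟨k, hk, hk'⟩ := exists_length (n := n) ha0 hε hε1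
  obtain ⟨l, hl, hl'⟩ := exists_length (n := n) hb0 hε hε1
  let err : (Fin P.lenA → Bool) → (Fin P.lenB → Bool) → Z → ℝ := fun u v z =>
    if P.referee u v = z then 0 else 1
  have herr0 : ∀ u v z, 0 ≤ err u v z := fun u v z => by simp only [err]; split_ifs <;> norm_num
  have herr1 : ∀ u v z, err u v z ≤ 1 := fun u v z => by simp only [err]; split_ifs <;> norm_num
  have avg0 : ∀ {M : Type} [Fintype M] {p h : M → ℝ}, p ∈ stdSimplex ℝ M → (∀ m, 0 ≤ h m) →
      0 ≤ ∑ m, p m * h m := fun hp hh => sum_nonneg fun m _ => mul_nonneg (hp.1 m) (hh m)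
  have avg1 : ∀ {M : Type} [Fintype M] {p h : M → ℝ}, p ∈ stdSimplex ℝ M → (∀ m, h m ≤ 1) →
      ∑ m, p m * h m ≤ 1 := fun hp hh => by
    rw [← hp.2]; exact sum_le_sum fun m _ => mul_le_of_le_one_right (hp.1 m) (hh m)
  obtain ⟨s, r, hr, hsr⟩ := exists_compression (I := Fin k → Bool) (S := A) (T := B)
    (p := fun x => P.aliceProb x) (q := chanAvg P.aliceProb)
    (h := fun x y u => ∑ v, P.bobProb y v * err u v (f x y))
    (fun x => P.aliceProb_mem x) (chanAvg_mem P.aliceProb_mem)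
    (fun x m h => eq_zero_of_chanAvg_eq_zero P.aliceProb_mem h x)
    (fun x y u => avg0 (P.bobProb_mem y) fun v => herr0 _ _ _)
    (fun x y u => avg1 (P.bobProb_mem y) fun v => herr1 _ _ _)
    (by positivity) (fun x => (mem_filter.1 x.2).2) hε hε1 (hcard A B) hk
  -- Bob's tests are the error probabilities against Alice's already compressed message, so the two
  -- losses of `2 * ε` simply add.
  obtain ⟨s', r', hr', hsr'⟩ := exists_compression (I := Fin l → Bool) (S := B) (T := A)
    (p := fun y => P.bobProb y) (q := chanAvg P.bobProb)
    (h := fun y x v => ∑ i, r x i * err (s i) v (f x y))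
    (fun x => P.bobProb_mem x) (chanAvg_mem P.bobProb_mem)
    (fun x m h => eq_zero_of_chanAvg_eq_zero P.bobProb_mem h x)
    (fun y x v => avg0 (hr x) fun i => herr0 _ _ _)
    (fun y x v => avg1 (hr x) fun i => herr1 _ _ _)
    (by positivity) (fun x => (mem_filter.1 x.2).2) hε hε1 (hcard B A) hl
  refine ⟨A, B, hA, hB, ⟨k, l, fun x => pmfOfSimplex (r x) (hr x),
    fun y => pmfOfSimplex (r' y) (hr' y), fun i j => P.referee (s i) (s' j)⟩, ?_, ?_⟩
  · intro x y
    have h1 := hsr x y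
    have h2 := hsr' y x
    have h3 := hP x y
    have h4 := P.one_sub_probOutput x y (f x y)
    rw [sub_le_comm, SimProtocol.one_sub_probOutput]
    simp only [SimProtocol.aliceProb, SimProtocol.bobProb, pmfOfSimplex_toReal, restrictRect]
    have e1 : ∑ i, r x i * ∑ j, r' y j * err (s i) (s' j) (f x y)
        = ∑ j, r' y j * ∑ i, r x i * err (s i) (s' j) (f x y) := by
      simp only [mul_sum]
      rw [sum_comm]
      exact sum_congr rfl fun j _ => sum_congr rfl fun i _ => by ring
    have e2 : ∑ i, r x i * ∑ v, P.bobProb y v * err (s i) v (f x y)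
        = ∑ v, P.bobProb y v * ∑ i, r x i * err (s i) v (f x y) := by
      simp only [mul_sum]
      rw [sum_comm]
      exact sum_congr rfl fun j _ => sum_congr rfl fun i _ => by ring
    change ∑ i, r x i * ∑ j, r' y j * err (s i) (s' j) (f x y) ≤ _
    change 1 - _ = ∑ u, P.aliceProb x u * ∑ v, P.bobProb y v * err u v (f x y) at h4
    linarith
  · rw [SimProtocol.infoCost_uniform, ← ha, ← hb]
    simp only [SimProtocol.cost, Nat.cast_add]
    have e : 3 / ε * (a + b) + 2 / ε = (3 * a + 1) / ε + (3 * b + 1) / ε := by ring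
    linarith

/-- The rectangle given by compression depends on `P`; passing to the minimum over large rectangles
makes the bound uniform in `P`. -/
theorem SimProtocol.infoCost_ge_RsimTilde {n : ℕ} {Z : Type*}
    {f : (Fin n → Bool) → (Fin n → Bool) → Z} {δ ε : ℝ} (hε : 0 < ε) (hε1 : ε < 1)
    (P : SimProtocol (Fin n → Bool) (Fin n → Bool) Z) (hP : P.Computes f δ) :
    ε / 3 * ((RsimTilde (δ + 4 * ε) f : ℝ) - 2 * Real.logb 2 (n + 1)
      - 2 * Real.logb 2 (1 / (ε ^ 2 * (1 - ε))) - 2 / ε - 8)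
      ≤ P.infoCost (PMF.uniformOfFintype ((Fin n → Bool) × (Fin n → Bool))) := by
  obtain ⟨A, B, hA, hB, P', hP', hcost⟩ := P.exists_compressed hε hε1 hP
  have h1 : RsimTilde (δ + 4 * ε) f ≤ P'.cost :=
    (Nat.sInf_le ⟨A, B, hA, hB, rfl⟩ : RsimTilde (δ + 4 * ε) f ≤ _).trans (Rsim_le_cost hP')
  have h2 : (RsimTilde (δ + 4 * ε) f : ℝ) ≤ P'.cost := by exact_mod_cast h1
  set J := P.infoCost (PMF.uniformOfFintype ((Fin n → Bool) × (Fin n → Bool)))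
  have h3 : J = ε / 3 * (3 / ε * J) := by field_simp
  rw [h3]
  exact mul_le_mul_of_nonneg_left (by linarith) (by positivity)

theorem mainTheorem6 {n : ℕ} {Z : Type*} (f : (Fin n → Bool) → (Fin n → Bool) → Z)
    (δ ε : ℝ) (hδ : 0 < δ) (hε : 0 < ε) (hε1 : ε < 1) :
    (∃ GoodA GoodB : Finset (Fin n → Bool), IsLarge GoodA ∧ IsLarge GoodB ∧
      ICsim δ f ≥ ε / 3 * ((Rsim (δ + 4 * ε) (restrictRect f GoodA GoodB) : ℝ)
        - 2 * Real.logb 2 (n + 1) - 2 * Real.logb 2 (1 / (ε ^ 2 * (1 - ε))) - 2 / ε - 8)) ∧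
    (∀ m : ℕ, (Rsim δ (directSumFun m f) : ℝ) ≥ m * ε / 3 * ((RsimTilde (δ + 4 * ε) f : ℝ)
        - 2 * Real.logb 2 (n + 1) - 2 * Real.logb 2 (1 / (ε ^ 2 * (1 - ε))) - 2 / ε - 8)) := by
  constructor
  -- The good sets are a rectangle attaining the minimum, so one choice serves all protocols in the
  -- infimum.
  · obtain ⟨A, B, hA, hB, hAB⟩ := Nat.sInf_mem (s := {c | ∃ A B : Finset (Fin n → Bool),
      IsLarge A ∧ IsLarge B ∧ Rsim (δ + 4 * ε) (restrictRect f A B) = c})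
      ⟨_, univ, univ, isLarge_univ n, isLarge_univ n, rfl⟩
    refine ⟨A, B, hA, hB, ?_⟩
    obtain ⟨P₀, hP₀⟩ := SimProtocol.exists_computes f hδ.le
    refine le_csInf ⟨_, P₀, hP₀, rfl⟩ ?_
    rintro _ ⟨P, hP, rfl⟩
    rw [hAB]
    exact P.infoCost_ge_RsimTilde hε hε1 hP
  · intro m
    -- Some protocol exists, so `Rsim` is attained and is not the default value 0 of an empty
    -- infimum.
    obtain ⟨P₀, hP₀⟩ := SimProtocol.exists_computes (directSumFun m f) hδ.le
    obtain ⟨P, hP, hcost⟩ := Nat.sInf_mem (s := {c | ∃ P : SimProtocol (Fin m → Fin n → Bool)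
      (Fin m → Fin n → Bool) (Fin m → Z), P.Computes (directSumFun m f) δ ∧ P.cost = c})
      ⟨_, P₀, hP₀, rfl⟩
    have hR : Rsim δ (directSumFun m f) = P.cost := hcost.symm
    rw [hR, ge_iff_le]
    refine le_trans ?_ P.infoCost_uniform_le_cost
    refine le_trans ?_ P.sum_infoCost_coord_le
    refine le_trans (le_of_eq ?_) (sum_le_sum fun i _ =>
      (P.coord i).infoCost_ge_RsimTilde hε hε1 (P.computes_coord hP i))
    rw [sum_const, card_univ, Fintype.card_fin, nsmul_eq_mul]
    ring
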